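/- All spaces are over the same scalar field $\mathbb K\in\{\mathbb R,\mathbb C\}$, and subspaces are closed. A Banach space $X$ is *subprojective* if every infinite-dimensional subspace of $X$ contains an infinite-dimensional subspace complemented in $X$, and *superprojective* if every infinite-codimensional subspace of $X$ is contained in an infinite-codimensional subspace complemented in $X$. It has the *Schur property* if every weakly convergent sequence in $X$ is norm convergent (to its weak limit). A bounded operator $T\colon X\to Y$ is *unconditionally converging* if there is no subspace $M$ of $X$ isomorphic to $c_0$ such that $T|_M$ is an isomorphism onto its image; $Sp(U^{-1}\circ K)$ is the class of Banach spaces $X$ such that, for every Banach space $Y$, every unconditionally converging operator $T\colon X\to Y$ is compact. Let $w=(w_n)_{n\ge 1}$ be a non-increasing sequence of positive numbers with $w_1=1$, $\lim_n w_n=0$ and $\sum_n w_n=\infty$. Let $d(w,1)$ be the Lorentz sequence space of all scalar sequences $x=(a_i)_{i\ge 1}$ with $$\|x\|=\sup_{\pi}\sum_{n=1}^\infty |a_{\pi(n)}|\,w_n<\infty,$$ the supremum being taken over all permutations $\pi$ of $\mathbb N$, and let $d(w,1)_*$ be the norm-closed linear span in $d(w,1)^*$ of the coordinate functionals $e_n^*$.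 Then: 1. $d(w,1)_*$ is a predual of $d(w,1)$: the map $x\mapsto (f\mapsto f(x))$ is an isometric isomorphism of $d(w,1)$ onto $(d(w,1)_*)^*$; 2. $d(w,1)$ is subprojective; 3. $d(w,1)_*$ is superprojective; 4. $d(w,1)$ fails the Schur property; 5. $d(w,1)_*\notin Sp(U^{-1}\circ K)$. -/

import Mathlib

open Filter Topology
open scoped ENNReal ZeroAtInfty

noncomputable section

/-! ### Subprojective and superprojective spaces -/

section Projectivity

variable (𝕜 : Type*) [RCLike 𝕜] (X : Type*) [NormedAddCommGroup X] [NormedSpace 𝕜 X]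
  [CompleteSpace X]

/-- A Banach space `X` is subprojective if every infinite-dimensional (closed) subspace of `X`
contains an infinite-dimensional (closed) subspace complemented in `X`. -/
def IsSubprojective : Prop :=
  ∀ M : Submodule 𝕜 X, IsClosed (M : Set X) → ¬ FiniteDimensional 𝕜 M →
    ∃ N : Submodule 𝕜 X, N ≤ M ∧ IsClosed (N : Set X) ∧ ¬ FiniteDimensional 𝕜 N ∧
      N.ClosedComplemented

/-- A Banach space `X` is superprojective if every infinite-codimensional (closed) subspace of `X`
is contained in an infinite-codimensional (closed) subspace complemented in `X`. -/
def IsSuperprojective : Prop :=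
  ∀ M : Submodule 𝕜 X, IsClosed (M : Set X) → ¬ FiniteDimensional 𝕜 (X ⧸ M) →
    ∃ N : Submodule 𝕜 X, M ≤ N ∧ IsClosed (N : Set X) ∧ ¬ FiniteDimensional 𝕜 (X ⧸ N) ∧
      N.ClosedComplemented

/-- The Schur property: weakly convergent sequences are norm convergent. -/
def HasSchurProperty : Prop :=
  ∀ (u : ℕ → X) (a : X),
    (∀ f : StrongDual 𝕜 X, Tendsto (fun n => f (u n)) atTop (𝓝 (f a))) →
      Tendsto u atTop (𝓝 a)

end Projectivity

/-- A bounded operator is unconditionally converging if there is no (closed) subspace `M`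
isomorphic to `c₀` on which it restricts to an isomorphism onto its image. -/
def IsUnconditionallyConverging {𝕜 X Y : Type*} [RCLike 𝕜]
    [NormedAddCommGroup X] [NormedSpace 𝕜 X] [NormedAddCommGroup Y] [NormedSpace 𝕜 Y]
    (T : X →L[𝕜] Y) : Prop :=
  ¬ ∃ M : Submodule 𝕜 X, IsClosed (M : Set X) ∧ Nonempty (M ≃L[𝕜] C₀(ℕ, 𝕜)) ∧
    ∃ c : ℝ, 0 < c ∧ ∀ x ∈ M, c * ‖x‖ ≤ ‖T x‖

/-- The class `Sp(U⁻¹ ∘ K)`: Banach spaces `X` such that every unconditionally converging operator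
from `X` into any Banach space is compact. -/
def MemSpUinvK.{u, v} (𝕜 : Type u) [RCLike 𝕜] (X : Type v) [NormedAddCommGroup X] [NormedSpace 𝕜 X]
    [CompleteSpace X] : Prop :=
  ∀ (Y : Type v) [NormedAddCommGroup Y] [NormedSpace 𝕜 Y] [CompleteSpace Y] (T : X →L[𝕜] Y),
    IsUnconditionallyConverging T → IsCompactOperator T

/-! ### The Lorentz sequence space `d(w, 1)` -/

/-- The weights defining Lorentz sequence spaces (indexed from `0`): non-increasing positive
sequences with `w₀ = 1`, `w n → 0` and `∑ w n = ∞`. -/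
structure LorentzWeight where
  toFun : ℕ → ℝ
  pos : ∀ n, 0 < toFun n
  antitone : Antitone toFun
  first : toFun 0 = 1
  tendsto_zero : Tendsto toFun atTop (𝓝 0)
  not_summable : ¬ Summable toFun

namespace LorentzSpace

variable {𝕜 : Type*} [RCLike 𝕜] (w : LorentzWeight)

/-- The `[0, ∞]`-valued norm `sup_π ∑ₙ |x (π n)| wₙ`, over all permutations `π` of `ℕ`. -/
def extNorm (x : ℕ → 𝕜) : ℝ≥0∞ :=
  ⨆ π : Equiv.Perm ℕ, ∑' n, ‖x (π n)‖ₑ * ENNReal.ofReal (w.toFun n)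

theorem extNorm_zero : extNorm w (0 : ℕ → 𝕜) = 0 := by simp [extNorm]

theorem extNorm_add_le (x y : ℕ → 𝕜) : extNorm w (x + y) ≤ extNorm w x + extNorm w y := by
  refine iSup_le fun π => ?_
  calc ∑' n, ‖(x + y) (π n)‖ₑ * ENNReal.ofReal (w.toFun n)
      ≤ ∑' n, (‖x (π n)‖ₑ * ENNReal.ofReal (w.toFun n)
          + ‖y (π n)‖ₑ * ENNReal.ofReal (w.toFun n)) := by
        refine ENNReal.tsum_le_tsum fun n => ?_
        rw [← add_mul]
        gcongr
        exact enorm_add_le _ _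
    _ = _ := ENNReal.tsum_add
    _ ≤ _ := add_le_add
        (le_iSup (fun π : Equiv.Perm ℕ => ∑' n, ‖x (π n)‖ₑ * ENNReal.ofReal (w.toFun n)) π)
        (le_iSup (fun π : Equiv.Perm ℕ => ∑' n, ‖y (π n)‖ₑ * ENNReal.ofReal (w.toFun n)) π)

theorem extNorm_smul (c : 𝕜) (x : ℕ → 𝕜) : extNorm w (c • x) = ‖c‖ₑ * extNorm w x := by
  simp only [extNorm, ENNReal.mul_iSup, ← ENNReal.tsum_mul_left, Pi.smul_apply, enorm_smul,
    mul_assoc]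

theorem enorm_apply_le (x : ℕ → 𝕜) (i : ℕ) : ‖x i‖ₑ ≤ extNorm w x := by
  refine le_trans ?_ (le_iSup _ (Equiv.swap 0 i))
  refine le_trans ?_ (ENNReal.le_tsum 0)
  simp [w.first]

variable (𝕜) in
/-- The sequences of scalars with `sup_π ∑ₙ |x (π n)| wₙ < ∞`. -/
def submodule : Submodule 𝕜 (ℕ → 𝕜) where
  carrier := {x | extNorm w x < ∞}
  zero_mem' := by simp [extNorm_zero]
  add_mem' {x y} hx hy := (extNorm_add_le w x y).trans_lt (ENNReal.add_lt_top.2 ⟨hx, hy⟩)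
  smul_mem' c x hx := by
    simp only [Set.mem_ofPred_eq, extNorm_smul] at hx ⊢
    exact ENNReal.mul_lt_top (by simp) hx

end LorentzSpace

/-- The Lorentz sequence space `d(w, 1)` over `𝕜`. -/
def LorentzSpace (𝕜 : Type*) [RCLike 𝕜] (w : LorentzWeight) : Type _ :=
  LorentzSpace.submodule 𝕜 w

namespace LorentzSpace

variable {𝕜 : Type*} [RCLike 𝕜] {w : LorentzWeight}

section Construction

variable (𝕜 w) in
/-- The pointwise group structure. -/
abbrev addCommGroup : AddCommGroup (LorentzSpace 𝕜 w) :=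
  inferInstanceAs (AddCommGroup (LorentzSpace.submodule 𝕜 w))

attribute [local instance] addCommGroup

variable (𝕜 w) in
/-- The pointwise scalar multiplication. -/
abbrev module : Module 𝕜 (LorentzSpace 𝕜 w) :=
  inferInstanceAs (Module 𝕜 (LorentzSpace.submodule 𝕜 w))

attribute [local instance] module

instance : CoeFun (LorentzSpace 𝕜 w) (fun _ => ℕ → 𝕜) := ⟨fun x => x.1⟩

theorem extNorm_ne_top (x : LorentzSpace 𝕜 w) : extNorm w ⇑x ≠ ∞ := ne_of_lt x.2

/-- The norm of `d(w, 1)`: `‖x‖ = sup_π ∑ₙ |x (π n)| wₙ`. -/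
instance : Norm (LorentzSpace 𝕜 w) := ⟨fun x => (extNorm w ⇑x).toReal⟩

theorem norm_def (x : LorentzSpace 𝕜 w) : ‖x‖ = (extNorm w ⇑x).toReal := rfl

theorem norm_apply_le_norm (x : LorentzSpace 𝕜 w) (i : ℕ) : ‖x i‖ ≤ ‖x‖ := by
  rw [norm_def, ← toReal_enorm]
  exact ENNReal.toReal_mono (extNorm_ne_top x) (enorm_apply_le w _ i)

theorem normedSpaceCore : NormedSpace.Core 𝕜 (LorentzSpace 𝕜 w) where
  norm_nonneg _ := ENNReal.toReal_nonneg
  norm_smul c x := by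
    change (extNorm w (c • ⇑x)).toReal = _
    rw [norm_def, extNorm_smul, ENNReal.toReal_mul, toReal_enorm]
  norm_triangle x y := by
    simp only [norm_def]
    rw [← ENNReal.toReal_add (extNorm_ne_top x) (extNorm_ne_top y)]
    exact ENNReal.toReal_mono (ENNReal.add_ne_top.2 ⟨extNorm_ne_top x, extNorm_ne_top y⟩)
      (extNorm_add_le w _ _)
  norm_eq_zero_iff x := by
    constructor
    · intro h
      refine Subtype.ext (funext fun i => ?_)
      have := norm_apply_le_norm x i
      rw [h] at this
      exact norm_le_zero_iff.1 this
    · rintro rfl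
      change (extNorm w (0 : ℕ → 𝕜)).toReal = 0
      simp [extNorm_zero]

instance : NormedAddCommGroup (LorentzSpace 𝕜 w) := NormedAddCommGroup.ofCore normedSpaceCore

instance : NormedSpace 𝕜 (LorentzSpace 𝕜 w) := NormedSpace.ofCore normedSpaceCore

end Construction

theorem coe_add (x y : LorentzSpace 𝕜 w) : ⇑(x + y) = ⇑x + ⇑y := rfl

theorem coe_sub (x y : LorentzSpace 𝕜 w) : ⇑(x - y) = ⇑x - ⇑y := rfl

theorem coe_smul (c : 𝕜) (x : LorentzSpace 𝕜 w) : ⇑(c • x) = c • ⇑x := rfl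

variable (𝕜 w) in
/-- The `n`-th coordinate functional `eₙ*` on `d(w, 1)`. -/
def coord (n : ℕ) : StrongDual 𝕜 (LorentzSpace 𝕜 w) :=
  LinearMap.mkContinuous
    { toFun := fun x => x n
      map_add' := fun _ _ => rfl
      map_smul' := fun _ _ => rfl } 1
    (fun x => (norm_apply_le_norm x n).trans_eq (one_mul _).symm)

instance : CompleteSpace (LorentzSpace 𝕜 w) := by
  refine Metric.complete_of_cauchySeq_tendsto fun u hu => ?_
  have hc : ∀ i, ∃ a : 𝕜, Tendsto (fun n => u n i) atTop (𝓝 a) := fun i =>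
    cauchySeq_tendsto_of_complete ((coord 𝕜 w i).uniformContinuous.comp_cauchySeq hu)
  choose x hx using hc
  have key : ∀ ε : ℝ, 0 < ε → ∃ N, ∀ m ≥ N, extNorm w (⇑(u m) - x) ≤ ENNReal.ofReal ε := by
    intro ε hε
    obtain ⟨N, hN⟩ := Metric.cauchySeq_iff.1 hu ε hε
    refine ⟨N, fun m hm => iSup_le fun π => ?_⟩
    refine ENNReal.tsum_le_of_sum_range_le fun k => ?_
    have ht : Tendsto (fun n => ∑ j ∈ Finset.range k,
        ‖(⇑(u m) - ⇑(u n)) (π j)‖ₑ * ENNReal.ofReal (w.toFun j)) atTop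
        (𝓝 (∑ j ∈ Finset.range k,
        ‖(⇑(u m) - x) (π j)‖ₑ * ENNReal.ofReal (w.toFun j))) := by
      refine tendsto_finsetSum _ fun j _ => ?_
      refine ENNReal.Tendsto.mul_const ?_ (Or.inr ENNReal.ofReal_ne_top)
      exact (tendsto_const_nhds.sub (hx (π j))).enorm
    refine le_of_tendsto ht ?_
    filter_upwards [eventually_ge_atTop N] with n hn
    have h1 := hN m hm n hn
    rw [dist_eq_norm, norm_def, coe_sub] at h1
    refine (ENNReal.sum_le_tsum _).trans ?_
    refine (le_iSup (fun π : Equiv.Perm ℕ => ∑' j,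
      ‖(⇑(u m) - ⇑(u n)) (π j)‖ₑ * ENNReal.ofReal (w.toFun j)) π).trans ?_
    refine (ENNReal.le_ofReal_iff_toReal_le ?_ hε.le).2 h1.le
    exact extNorm_ne_top (u m - u n)
  have hmem : extNorm w x < ∞ := by
    obtain ⟨N, hN⟩ := key 1 one_pos
    have h2 := hN N le_rfl
    have h3 : ⇑(u N) - (⇑(u N) - x) ∈ submodule 𝕜 w :=
      Submodule.sub_mem _ (u N).2 (h2.trans_lt ENNReal.ofReal_lt_top)
    rwa [sub_sub_cancel] at h3
  obtain ⟨y, rfl⟩ : ∃ y : LorentzSpace 𝕜 w, ⇑y = x := ⟨⟨x, hmem⟩, rfl⟩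
  refine ⟨y, Metric.tendsto_atTop.2 fun ε hε => ?_⟩
  obtain ⟨N, hN⟩ := key (ε / 2) (half_pos hε)
  refine ⟨N, fun m hm => ?_⟩
  rw [dist_eq_norm, norm_def, coe_sub]
  exact (ENNReal.toReal_le_of_le_ofReal (half_pos hε).le (hN m hm)).trans_lt (half_lt_self hε)

end LorentzSpace

/-- The norm closed linear span of the coordinate functionals in the dual of `d(w, 1)`. -/
def LorentzSpace.coordSpan (𝕜 : Type*) [RCLike 𝕜] (w : LorentzWeight) :
    Submodule 𝕜 (StrongDual 𝕜 (LorentzSpace 𝕜 w)) :=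
  (Submodule.span 𝕜 (Set.range (LorentzSpace.coord 𝕜 w))).topologicalClosure

/-- The predual `d(w, 1)_*`: the closed linear span of the coordinate functionals in the dual of
`d(w, 1)`, with the dual norm. -/
def LorentzPredual (𝕜 : Type*) [RCLike 𝕜] (w : LorentzWeight) : Type _ :=
  LorentzSpace.coordSpan 𝕜 w

namespace LorentzPredual

variable {𝕜 : Type*} [RCLike 𝕜] {w : LorentzWeight}

instance : NormedAddCommGroup (LorentzPredual 𝕜 w) :=
  inferInstanceAs (NormedAddCommGroup (LorentzSpace.coordSpan 𝕜 w))

instance : NormedSpace 𝕜 (LorentzPredual 𝕜 w) :=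
  inferInstanceAs (NormedSpace 𝕜 (LorentzSpace.coordSpan 𝕜 w))

instance : CompleteSpace (LorentzPredual 𝕜 w) :=
  (Submodule.isClosed_topologicalClosure
    (Submodule.span 𝕜 (Set.range (LorentzSpace.coord 𝕜 w)))).completeSpace_coe

/-- An element of the predual, as a bounded functional on `d(w, 1)`. -/
def toDual (f : LorentzPredual 𝕜 w) : StrongDual 𝕜 (LorentzSpace 𝕜 w) := f.1

end LorentzPredual

end

/-! The norm of `d(w, 1)` dominates every sum pairing distinct weights with distinct coordinates
(`sum_le_norm`), so functionals `∑ c j • coord (π j)` with `‖c j‖ ≤ w j` have norm at most one.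
Testing on them identifies a functional on the predual with its sequence of values at the coordinate
functionals, which gives the duality.

Both spaces embed in `c₀` through their coordinates, and this embedding is not bounded below on any
infinite-dimensional subspace (`exists_flat_of_growth`). The reason is a growth condition: `k`
coordinates of size `δ` force norm at least `δ * W k` in `d(w, 1)` and `δ * (k / W k)` in its dual,
with `W k = w 0 + ⋯ + w (k - 1)`; both factors are unbounded since `∑ w = ∞` and `w → 0`.

In an infinite-dimensional subspace of `d(w, 1)`, flat vectors therefore yield normalized `x n` and
functionals `g n` in the predual that use disjoint sets of coordinates and of weights
(`exists_almostBiorthogonal`). The `g n` satisfy an upper `c₀` estimate, and `f ↦ (f (x n))` maps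
the predual to `c₀` with a bounded right inverse. Its adjoint embeds the dual of `c₀` as a
complemented subspace inside the given one: this is subprojectivity. Applied to the annihilator of a
subspace of the predual, the kernel of the same operator gives superprojectivity.

The unit vectors are normalized and weakly null, so the Schur property fails. The coordinate
embedding of the predual in `c₀` is not compact, yet it is bounded below on no copy of `c₀`. -/

/-! ### Weights -/

namespace LorentzWeight

variable (w : LorentzWeight)

/-- The partial sums `w 0 + ⋯ + w (k - 1)`. -/
noncomputable def partialSum (k : ℕ) : ℝ := ∑ j ∈ Finset.range k, w.toFun j

theorem tendsto_partialSum : Tendsto w.partialSum atTop atTop :=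
  (not_summable_iff_tendsto_nat_atTop_of_nonneg fun n => (w.pos n).le).1 w.not_summable

theorem partialSum_pos {k : ℕ} (hk : 0 < k) : 0 < w.partialSum k :=
  Finset.sum_pos (fun j _ => w.pos j) (Finset.nonempty_range_iff.2 hk.ne')

/-- The reciprocals are the Cesàro means of a null sequence. -/
theorem tendsto_div_partialSum :
    Tendsto (fun k : ℕ => (k : ℝ) / w.partialSum k) atTop atTop := by
  have h : Tendsto (fun k : ℕ => (k : ℝ)⁻¹ * w.partialSum k) atTop (𝓝[>] 0) := by
    refine tendsto_nhdsWithin_iff.2 ⟨w.tendsto_zero.cesaro, ?_⟩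
    filter_upwards [eventually_gt_atTop 0] with k hk
    have := w.partialSum_pos hk
    simp only [Set.mem_Ioi]
    positivity
  refine h.inv_tendsto_nhdsGT_zero.congr fun k => ?_
  simp [div_eq_mul_inv, mul_comm]

/-- An index above all of `s` is at least `s.card`, so its weight is at most the next term of the
partial sum. -/
theorem sum_le_partialSum (s : Finset ℕ) : ∑ j ∈ s, w.toFun j ≤ w.partialSum s.card := by
  induction s using Finset.induction_on_max with
  | empty => simp [partialSum]
  | insert a s hs ih =>
    have ha : a ∉ s := fun h => lt_irrefl _ (hs a h)
    have hcard : s.card ≤ a := by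
      have : s ⊆ Finset.range a := fun i hi => Finset.mem_range.2 (hs i hi)
      simpa using Finset.card_le_card this
    rw [Finset.sum_insert ha, Finset.card_insert_of_notMem ha, partialSum,
      Finset.sum_range_succ, add_comm]
    exact add_le_add ih (w.antitone hcard)

end LorentzWeight

/-! ### Flat vectors in infinite-dimensional subspaces -/

section Flat

variable {𝕜 : Type*} [RCLike 𝕜]

theorem RCLike.exists_norm_le_one_mul_eq_norm (z : 𝕜) : ∃ θ : 𝕜, ‖θ‖ ≤ 1 ∧ θ * z = (‖z‖ : 𝕜) := by
  rcases eq_or_ne z 0 with rfl | hz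
  · exact ⟨0, by simp⟩
  · have hz' : (‖z‖ : 𝕜) ≠ 0 := by simpa using hz
    refine ⟨(starRingEnd 𝕜) z / ‖z‖, ?_, ?_⟩
    · simp [hz]
    · rw [div_mul_eq_mul_div, RCLike.conj_mul, pow_two, mul_div_assoc, div_self hz', mul_one]

theorem Submodule.not_finiteDimensional_inf_ker {K V V' : Type*} [Field K] [AddCommGroup V]
    [Module K V] [AddCommGroup V'] [Module K V'] [FiniteDimensional K V'] {M : Submodule K V}
    (hM : ¬ FiniteDimensional K M) (Φ : V →ₗ[K] V') :
    ¬ FiniteDimensional K (M ⊓ LinearMap.ker Φ : Submodule K V) := fun h =>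
  hM <| Module.Finite.iff_fg.2 <| Submodule.fg_of_fg_map_of_fg_inf_ker Φ
    (Module.Finite.iff_fg.1 inferInstance) (Module.Finite.iff_fg.1 h)

theorem Submodule.exists_ne_zero_of_not_finiteDimensional {K V : Type*} [Field K] [AddCommGroup V]
    [Module K V] {M : Submodule K V} (hM : ¬ FiniteDimensional K M) : ∃ x ∈ M, x ≠ 0 := by
  refine M.exists_mem_ne_zero_of_ne_bot ?_
  rintro rfl
  exact hM inferInstance

variable {E : Type*} [NormedAddCommGroup E] [NormedSpace 𝕜 E]

/-- If vectors with `k` coordinates bounded below by `δ` have norm at least `δ * g k`, where `g`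
is unbounded, then all vectors have coordinates tending to zero. -/
theorem tendsto_zero_of_growth {J : ℕ → E →ₗ[𝕜] 𝕜} {g : ℕ → ℝ} (hg : Tendsto g atTop atTop)
    (hJ : ∀ (f : E) (s : Finset ℕ) (δ : ℝ), 0 ≤ δ → (∀ i ∈ s, δ ≤ ‖J i f‖) →
      δ * g s.card ≤ ‖f‖) (f : E) : Tendsto (fun i => J i f) atTop (𝓝 0) := by
  rw [Metric.tendsto_atTop]
  by_contra! hcon
  obtain ⟨δ, hδ, hcon⟩ := hcon
  have hinf : {i | δ ≤ ‖J i f‖}.Infinite := by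
    refine Set.infinite_of_not_bddAbove fun ⟨N, hN⟩ => ?_
    obtain ⟨n, hn, h⟩ := hcon (N + 1)
    have : n ≤ N := hN (by simpa using h)
    omega
  obtain ⟨k, hk⟩ := (hg.eventually_gt_atTop (‖f‖ / δ)).exists
  obtain ⟨s, hs, rfl⟩ := hinf.exists_subset_card_eq k
  have := hJ f s δ hδ.le fun i hi => hs hi
  rw [div_lt_iff₀ hδ] at hk
  linarith

/-- Under the growth condition of `tendsto_zero_of_growth`, every infinite-dimensional subspace
contains vectors all of whose coordinates are small compared with the norm. -/
theorem exists_flat_of_growth {J : ℕ → E →ₗ[𝕜] 𝕜} {g : ℕ → ℝ} (hg : Tendsto g atTop atTop)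
    (hJ : ∀ (f : E) (s : Finset ℕ) (δ : ℝ), 0 ≤ δ → (∀ i ∈ s, δ ≤ ‖J i f‖) →
      δ * g s.card ≤ ‖f‖) {M : Submodule 𝕜 E} (hM : ¬ FiniteDimensional 𝕜 M) {c : ℝ}
    (hc : 0 < c) : ∃ f ∈ M, f ≠ 0 ∧ ∀ i, ‖J i f‖ ≤ c * ‖f‖ := by
  -- Otherwise the sup of the coordinates is equivalent to the norm on `M`; a gliding hump then
  -- contradicts the growth condition.
  by_contra! hcon
  have step : ∀ N : ℕ, ∃ f ∈ M, (∀ i < N, J i f = 0) ∧ (∀ i, ‖J i f‖ ≤ 1) ∧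
      ∃ i ≥ N, ‖J i f‖ = 1 := by
    intro N
    obtain ⟨f, ⟨hfM, hfN⟩, hf⟩ := Submodule.exists_ne_zero_of_not_finiteDimensional
      (Submodule.not_finiteDimensional_inf_ker hM (LinearMap.pi fun i : Fin N => J i))
    have hfN' : ∀ i < N, J i f = 0 := fun i hi => congrFun hfN ⟨i, hi⟩
    obtain ⟨i₀, hi₀⟩ := hcon f hfM hf
    have hpos : 0 < ‖J i₀ f‖ := lt_of_le_of_lt (by positivity) hi₀
    have hlim : Tendsto (fun i => ‖J i f‖) atTop (𝓝 0) := by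
      simpa using (tendsto_zero_of_growth hg hJ f).norm
    -- Coordinates tend to zero, so the largest modulus is attained and one can normalize it to `1`.
    obtain ⟨n, hn⟩ := eventually_atTop.1 (hlim.eventually_lt_const hpos)
    obtain ⟨i, -, hi⟩ := Finset.exists_max_image (insert i₀ (Finset.range n))
      (fun i => ‖J i f‖) ⟨i₀, by simp⟩
    have hmax : ∀ j, ‖J j f‖ ≤ ‖J i f‖ := by
      intro j
      by_cases hj : j < n
      · exact hi j (by simp [hj])
      · exact (hn j (not_lt.1 hj)).le.trans (hi i₀ (by simp))
    have hpos' : 0 < ‖J i f‖ := hpos.trans_le (hmax i₀)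
    refine ⟨(J i f)⁻¹ • f, M.smul_mem _ hfM, fun j hj => by simp [hfN' j hj], fun j => ?_, i, ?_, ?_⟩
    · rw [map_smul, norm_smul, norm_inv, inv_mul_le_iff₀ hpos', mul_one]
      exact hmax j
    · by_contra h
      rw [hfN' i (not_le.1 h), norm_zero] at hpos'
      exact lt_irrefl _ hpos'
    · rw [map_smul, norm_smul, norm_inv, inv_mul_cancel₀ hpos'.ne']
  -- The next vector is added where the previous sum is at most `1 / 2` and vanishes before that:
  -- its coordinate of modulus `1` stays above `1 / 2`, and no coordinate exceeds `3 / 2`.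
  have ind : ∀ k : ℕ, ∃ f ∈ M, ∃ s : Finset ℕ, s.card = k ∧ (∀ i ∈ s, 1 / 2 ≤ ‖J i f‖) ∧
      ∀ i, ‖J i f‖ ≤ 3 / 2 := by
    intro k
    induction k with
    | zero => exact ⟨0, M.zero_mem, ∅, by simp, by simp, fun i => by simp; norm_num⟩
    | succ k ih =>
      obtain ⟨F, hF, s, hs, hlow, hup⟩ := ih
      have hlim : Tendsto (fun i => ‖J i F‖) atTop (𝓝 0) := by
        simpa using (tendsto_zero_of_growth hg hJ F).norm
      obtain ⟨N₀, hN₀⟩ := eventually_atTop.1 (hlim.eventually_le_const (by norm_num : (0:ℝ) < 1 / 2))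
      obtain ⟨N₁, hN₁⟩ := s.bddAbove
      obtain ⟨f, hf, hf0, hf1, i, hi, hfi⟩ := step (N₀ + N₁ + 1)
      have his : i ∉ s := fun h => by have := hN₁ h; omega
      refine ⟨F + f, M.add_mem hF hf, insert i s, by simp [his, hs], ?_, fun j => ?_⟩
      · intro j hj
        rcases Finset.mem_insert.1 hj with rfl | hj
        · have h1 := hN₀ j (by omega)
          have h2 := norm_sub_norm_le (J j f) (-(J j F))
          rw [map_add, add_comm]
          rw [norm_neg, sub_neg_eq_add] at h2
          linarith
        · rw [map_add, hf0 j (by have := hN₁ hj; omega), add_zero]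
          exact hlow j hj
      · rw [map_add]
        by_cases hj : j < N₀ + N₁ + 1
        · rw [hf0 j hj, add_zero]
          exact hup j
        · have h1 := hN₀ j (by omega)
          have h2 := hf1 j
          exact (norm_add_le _ _).trans (by linarith)
  -- Growth gives `g k / 2 ≤ ‖f‖`, while flatness fails only if `c * ‖f‖ < 3 / 2`.
  obtain ⟨k, hk, hk0⟩ := ((hg.eventually_gt_atTop (3 / c)).and (hg.eventually_gt_atTop 0)).exists
  obtain ⟨f, hf, s, rfl, hlow, hup⟩ := ind k
  have h1 := hJ f s (1 / 2) (by norm_num) hlow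
  have hf0 : f ≠ 0 := by
    rintro rfl
    rw [norm_zero] at h1
    linarith
  obtain ⟨i, hi⟩ := hcon f hf hf0
  have h2 := hup i
  rw [div_lt_iff₀ hc] at hk
  nlinarith

end Flat

/-! ### The norm of the Lorentz space -/

/-- The complements of the two finite images are countably infinite, so any bijection between them
completes the partial one. -/
theorem Equiv.Perm.exists_apply_eq_of_injOn {ι : Type*} (s : Finset ι) {a b : ι → ℕ}
    (ha : Set.InjOn a s) (hb : Set.InjOn b s) :
    ∃ π : Equiv.Perm ℕ, ∀ t ∈ s, π (b t) = a t := by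
  classical
  have hinf : ∀ c : ι → ℕ, Infinite {n // ¬ n ∈ c '' (s : Set ι)} := fun c =>
    ((s.finite_toSet.image c).infinite_compl).to_subtype
  have := hinf a
  have := hinf b
  obtain ⟨e₂⟩ : Nonempty ({n // ¬ n ∈ b '' (s : Set ι)} ≃ {n // ¬ n ∈ a '' (s : Set ι)}) :=
    nonempty_equiv_of_countable
  let e₁ : {n // n ∈ b '' (s : Set ι)} ≃ {n // n ∈ a '' (s : Set ι)} :=
    (hb.bijOn_image.equiv b).symm.trans (ha.bijOn_image.equiv a)
  refine ⟨Equiv.subtypeCongr e₁ e₂, fun t ht => ?_⟩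
  have hmem : b t ∈ b '' (s : Set ι) := ⟨t, ht, rfl⟩
  have h1 : (hb.bijOn_image.equiv b).symm ⟨b t, hmem⟩ = ⟨t, ht⟩ := by
    rw [Equiv.symm_apply_eq]; rfl
  rw [Equiv.subtypeCongr]
  simp only [Equiv.trans_apply]
  rw [Equiv.sumCompl_symm_apply_of_pos hmem]
  simp only [Equiv.sumCongr_apply, Sum.map_inl, Equiv.sumCompl_apply_inl, e₁, Equiv.trans_apply]
  rw [h1]
  rfl

namespace LorentzSpace

variable {𝕜 : Type*} [RCLike 𝕜] {w : LorentzWeight}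

/-- An arbitrary index type allows sums from several blocks, each with its own permutation, to be
merged into one admissible sum. -/
theorem sum_le_norm {ι : Type*} (x : LorentzSpace 𝕜 w) (s : Finset ι) {a b : ι → ℕ}
    (ha : Set.InjOn a s) (hb : Set.InjOn b s) :
    ∑ t ∈ s, w.toFun (b t) * ‖x (a t)‖ ≤ ‖x‖ := by
  classical
  obtain ⟨π, hπ⟩ := Equiv.Perm.exists_apply_eq_of_injOn s ha hb
  rw [norm_def]
  refine (ENNReal.ofReal_le_iff_le_toReal (extNorm_ne_top x)).1 ?_
  refine le_trans ?_ (le_iSup _ π)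
  refine le_trans ?_ (ENNReal.sum_le_tsum (s.image b))
  rw [Finset.sum_image hb, ENNReal.ofReal_sum_of_nonneg fun t _ =>
    mul_nonneg (w.pos _).le (norm_nonneg _)]
  refine Finset.sum_le_sum fun t ht => ?_
  rw [hπ t ht, ENNReal.ofReal_mul (w.pos _).le, ofReal_norm, mul_comm]

theorem extNorm_le {x : ℕ → 𝕜} {C : ℝ}
    (h : ∀ (π : Equiv.Perm ℕ) (k : ℕ), ∑ j ∈ Finset.range k, w.toFun j * ‖x (π j)‖ ≤ C) :
    extNorm w x ≤ ENNReal.ofReal C := by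
  refine iSup_le fun π => ENNReal.tsum_le_of_sum_range_le fun k => ?_
  refine le_trans (le_of_eq ?_) (ENNReal.ofReal_le_ofReal (h π k))
  rw [ENNReal.ofReal_sum_of_nonneg fun t _ => mul_nonneg (w.pos _).le (norm_nonneg _)]
  refine Finset.sum_congr rfl fun j _ => ?_
  rw [ENNReal.ofReal_mul (w.pos _).le, ofReal_norm, mul_comm]

theorem norm_le_of_sum_le {x : LorentzSpace 𝕜 w} {C : ℝ}
    (h : ∀ (π : Equiv.Perm ℕ) (k : ℕ), ∑ j ∈ Finset.range k, w.toFun j * ‖x (π j)‖ ≤ C) :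
    ‖x‖ ≤ C := by
  have hC : 0 ≤ C := by simpa using h 1 0
  exact ENNReal.toReal_le_of_le_ofReal hC (extNorm_le h)

theorem mul_partialSum_le_norm (x : LorentzSpace 𝕜 w) (s : Finset ℕ) (δ : ℝ) (_ : 0 ≤ δ)
    (h : ∀ i ∈ s, δ ≤ ‖x i‖) : δ * w.partialSum s.card ≤ ‖x‖ := by
  have h1 := sum_le_norm x (Finset.univ : Finset (Fin s.card))
    (a := fun j => (s.equivFin.symm j : ℕ)) (b := fun j => (j : ℕ))
    (fun i _ j _ hij => s.equivFin.symm.injective (Subtype.ext hij))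
    (fun i _ j _ hij => Fin.ext hij)
  refine le_trans ?_ h1
  rw [LorentzWeight.partialSum, Finset.mul_sum, ← Fin.sum_univ_eq_sum_range (fun j => δ * w.toFun j)]
  refine Finset.sum_le_sum fun j _ => ?_
  rw [mul_comm]
  exact mul_le_mul_of_nonneg_left (h _ (s.equivFin.symm j).2) (w.pos _).le

/-! ### Finitely supported vectors -/

/-- At most `s.card` weights meet the support, and the first ones are the largest. -/
theorem sum_indicator_le (s : Finset ℕ) (θ : ℕ → 𝕜) (hθ : ∀ i, ‖θ i‖ ≤ 1) (π : Equiv.Perm ℕ)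
    (k : ℕ) : ∑ j ∈ Finset.range k, w.toFun j * ‖(s : Set ℕ).indicator θ (π j)‖ ≤
      w.partialSum s.card := by
  classical
  calc ∑ j ∈ Finset.range k, w.toFun j * ‖(s : Set ℕ).indicator θ (π j)‖
      ≤ ∑ j ∈ Finset.range k, if π j ∈ s then w.toFun j else 0 := by
        refine Finset.sum_le_sum fun j _ => ?_
        by_cases hj : π j ∈ s
        · rw [Set.indicator_of_mem (by exact hj), if_pos hj]
          exact mul_le_of_le_one_right (w.pos j).le (hθ _)
        · rw [Set.indicator_of_notMem (by exact hj), if_neg hj]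
          simp
    _ = ∑ j ∈ (Finset.range k).filter (fun j => π j ∈ s), w.toFun j :=
        (Finset.sum_filter _ _).symm
    _ ≤ w.partialSum ((Finset.range k).filter (fun j => π j ∈ s)).card := w.sum_le_partialSum _
    _ ≤ w.partialSum s.card := by
        refine Finset.sum_le_sum_of_subset_of_nonneg (Finset.range_mono ?_) fun j _ _ => (w.pos j).le
        exact Finset.card_le_card_of_injOn π (fun j hj => (Finset.mem_filter.1 hj).2)
          π.injective.injOn

variable (w) in
/-- The vector with coordinates `θ` on the finite set `s` and zero elsewhere, for `θ` bounded
by `1`. -/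
noncomputable def ofFinset (s : Finset ℕ) (θ : ℕ → 𝕜) (hθ : ∀ i, ‖θ i‖ ≤ 1) : LorentzSpace 𝕜 w :=
  ⟨(s : Set ℕ).indicator θ, (extNorm_le (sum_indicator_le s θ hθ)).trans_lt ENNReal.ofReal_lt_top⟩

theorem norm_ofFinset_le (s : Finset ℕ) (θ : ℕ → 𝕜) (hθ : ∀ i, ‖θ i‖ ≤ 1) :
    ‖ofFinset w s θ hθ‖ ≤ w.partialSum s.card :=
  norm_le_of_sum_le (sum_indicator_le s θ hθ)

variable (𝕜 w) in
/-- The unit vector `eₙ`. -/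
noncomputable def unit (n : ℕ) : LorentzSpace 𝕜 w := ofFinset w {n} 1 (by simp)

theorem unit_apply (n i : ℕ) : unit 𝕜 w n i = if i = n then 1 else 0 := by
  change (({n} : Finset ℕ) : Set ℕ).indicator 1 i = _
  by_cases h : i = n <;> simp [h]

theorem norm_unit (n : ℕ) : ‖unit 𝕜 w n‖ = 1 := by
  refine le_antisymm ?_ ?_
  · refine (norm_ofFinset_le _ _ _).trans_eq ?_
    simp [LorentzWeight.partialSum, w.first]
  · have := norm_apply_le_norm (unit 𝕜 w n) n
    simpa [unit_apply] using this

theorem coe_sum {ι : Type*} (s : Finset ι) (u : ι → LorentzSpace 𝕜 w) (i : ℕ) :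
    (∑ t ∈ s, u t : LorentzSpace 𝕜 w) i = ∑ t ∈ s, u t i :=
  map_sum (coord 𝕜 w i) u s

theorem ofFinset_eq_sum (s : Finset ℕ) (θ : ℕ → 𝕜) (hθ : ∀ i, ‖θ i‖ ≤ 1) :
    ofFinset w s θ hθ = ∑ i ∈ s, θ i • unit 𝕜 w i := by
  refine Subtype.ext (funext fun j => ?_)
  rw [coe_sum]
  change (s : Set ℕ).indicator θ j = _
  simp [coe_smul, unit_apply, Set.indicator_apply]

/-- The growth condition for the dual: test `f` on the vector supported by `s` whose phases align
the values `f (unit 𝕜 w i)`. -/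
theorem mul_div_partialSum_le_norm (f : StrongDual 𝕜 (LorentzSpace 𝕜 w)) (s : Finset ℕ) (δ : ℝ)
    (_ : 0 ≤ δ) (h : ∀ i ∈ s, δ ≤ ‖f (unit 𝕜 w i)‖) :
    δ * (s.card / w.partialSum s.card) ≤ ‖f‖ := by
  rcases s.eq_empty_or_nonempty with rfl | hs
  · simp
  choose θ hθ hθf using fun i => RCLike.exists_norm_le_one_mul_eq_norm (f (unit 𝕜 w i))
  have hpos := w.partialSum_pos hs.card_pos
  rw [← mul_div_assoc, div_le_iff₀ hpos]
  calc δ * s.card ≤ ∑ i ∈ s, ‖f (unit 𝕜 w i)‖ := by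
        rw [mul_comm, ← nsmul_eq_mul]
        exact Finset.card_nsmul_le_sum s _ δ h
    _ = ‖f (ofFinset w s θ hθ)‖ := by
        rw [ofFinset_eq_sum, map_sum]
        simp only [map_smul, smul_eq_mul, hθf]
        rw [← RCLike.ofReal_sum, RCLike.norm_ofReal,
          abs_of_nonneg (Finset.sum_nonneg fun i _ => norm_nonneg _)]
    _ ≤ ‖f‖ * w.partialSum s.card :=
        (f.le_opNorm _).trans (by gcongr; exact norm_ofFinset_le s θ hθ)

theorem tendsto_apply_unit (f : StrongDual 𝕜 (LorentzSpace 𝕜 w)) :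
    Tendsto (fun n => f (unit 𝕜 w n)) atTop (𝓝 0) :=
  tendsto_zero_of_growth (J := fun i => (ContinuousLinearMap.apply 𝕜 𝕜 (unit 𝕜 w i)).toLinearMap)
    w.tendsto_div_partialSum (fun f => mul_div_partialSum_le_norm f) f

theorem not_hasSchurProperty : ¬ HasSchurProperty 𝕜 (LorentzSpace 𝕜 w) := fun h => by
  have h1 := h (unit 𝕜 w) 0 fun f => by simpa using tendsto_apply_unit f
  have h2 := h1.norm
  simp only [norm_unit, norm_zero] at h2
  exact one_ne_zero (tendsto_nhds_unique tendsto_const_nhds h2)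

end LorentzSpace

/-! ### The predual -/

namespace LorentzSpace

variable {𝕜 : Type*} [RCLike 𝕜] {w : LorentzWeight}

theorem coord_apply (n : ℕ) (x : LorentzSpace 𝕜 w) : coord 𝕜 w n x = x n := rfl

theorem coord_mem_coordSpan (n : ℕ) : coord 𝕜 w n ∈ coordSpan 𝕜 w :=
  Submodule.le_topologicalClosure _ (Submodule.subset_span ⟨n, rfl⟩)

theorem sum_smul_coord_apply {ι : Type*} (s : Finset ι) (c : ι → 𝕜) (a : ι → ℕ)
    (x : LorentzSpace 𝕜 w) : (∑ t ∈ s, c t • coord 𝕜 w (a t)) x = ∑ t ∈ s, c t * x (a t) := by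
  simp [coord_apply]

theorem norm_sum_smul_coord_le {ι : Type*} (s : Finset ι) {c : ι → 𝕜} {a b : ι → ℕ}
    (ha : Set.InjOn a s) (hb : Set.InjOn b s) (hc : ∀ t ∈ s, ‖c t‖ ≤ w.toFun (b t)) :
    ‖∑ t ∈ s, c t • coord 𝕜 w (a t)‖ ≤ 1 := by
  refine ContinuousLinearMap.opNorm_le_bound _ zero_le_one fun x => ?_
  rw [sum_smul_coord_apply, one_mul]
  refine (norm_sum_le _ _).trans ((Finset.sum_le_sum fun t ht => ?_).trans (sum_le_norm x s ha hb))
  rw [norm_mul]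
  exact mul_le_mul_of_nonneg_right (hc t ht) (norm_nonneg _)

theorem norm_coord_le (n : ℕ) : ‖coord 𝕜 w n‖ ≤ 1 :=
  ContinuousLinearMap.opNorm_le_bound _ zero_le_one fun x => by
    simpa [coord_apply] using norm_apply_le_norm x n

end LorentzSpace

namespace LorentzPredual

open LorentzSpace

variable {𝕜 : Type*} [RCLike 𝕜] {w : LorentzWeight}

variable (𝕜 w) in
/-- The inclusion of the predual in the dual of `d(w, 1)`. -/
noncomputable def toDualL : LorentzPredual 𝕜 w →ₗᵢ[𝕜] StrongDual 𝕜 (LorentzSpace 𝕜 w) :=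
  (coordSpan 𝕜 w).subtypeₗᵢ

theorem norm_toDual (f : LorentzPredual 𝕜 w) : ‖f.toDual‖ = ‖f‖ := rfl

theorem norm_toDual_apply_le (f : LorentzPredual 𝕜 w) (x : LorentzSpace 𝕜 w) :
    ‖f.toDual x‖ ≤ ‖f‖ * ‖x‖ := f.toDual.le_opNorm x

variable (𝕜 w) in
/-- The coordinate functional `eₙ*`, as an element of the predual. -/
noncomputable def coord (n : ℕ) : LorentzPredual 𝕜 w :=
  ⟨LorentzSpace.coord 𝕜 w n, coord_mem_coordSpan n⟩

theorem toDual_sum {ι : Type*} (s : Finset ι) (f : ι → LorentzPredual 𝕜 w) :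
    (∑ t ∈ s, f t).toDual = ∑ t ∈ s, (f t).toDual := map_sum (toDualL 𝕜 w) f s

theorem toDual_smul (c : 𝕜) (f : LorentzPredual 𝕜 w) : (c • f).toDual = c • f.toDual := rfl

theorem toDual_add (f g : LorentzPredual 𝕜 w) : (f + g).toDual = f.toDual + g.toDual := rfl

theorem norm_sum_smul_coord_le {ι : Type*} (s : Finset ι) {c : ι → 𝕜} {a b : ι → ℕ}
    (ha : Set.InjOn a s) (hb : Set.InjOn b s) (hc : ∀ t ∈ s, ‖c t‖ ≤ w.toFun (b t)) :
    ‖∑ t ∈ s, c t • coord 𝕜 w (a t)‖ ≤ 1 := by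
  rw [← norm_toDual, toDual_sum]
  exact LorentzSpace.norm_sum_smul_coord_le s ha hb hc

theorem norm_coord_le (n : ℕ) : ‖coord 𝕜 w n‖ ≤ 1 := LorentzSpace.norm_coord_le n

theorem closure_span_coord : (Submodule.span 𝕜 (Set.range (coord 𝕜 w))).topologicalClosure = ⊤ := by
  have hind : IsInducing (toDualL 𝕜 w) := (toDualL 𝕜 w).isometry.isUniformInducing.isInducing
  rw [eq_top_iff]
  intro f _
  change f ∈ closure ((Submodule.span 𝕜 (Set.range (coord 𝕜 w)) : Set (LorentzPredual 𝕜 w)))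
  rw [hind.closure_eq_preimage_closure_image]
  have himg : (toDualL 𝕜 w) '' (Submodule.span 𝕜 (Set.range (coord 𝕜 w)) : Set _) =
      (Submodule.span 𝕜 (Set.range (LorentzSpace.coord 𝕜 w)) : Set _) := by
    have := Submodule.map_span (toDualL 𝕜 w).toLinearMap (Set.range (coord 𝕜 w))
    rw [← Set.range_comp] at this
    exact congrArg SetLike.coe this
  rw [himg]
  exact f.2

/-- Every element of the predual tends to zero along a bounded sequence of `d(w, 1)` which tends
to zero coordinatewise. -/
theorem tendsto_toDual_zero {x : ℕ → LorentzSpace 𝕜 w} {C : ℝ} (hC : ∀ n, ‖x n‖ ≤ C)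
    (hx : ∀ i, Tendsto (fun n => x n i) atTop (𝓝 0)) (f : LorentzPredual 𝕜 w) :
    Tendsto (fun n => f.toDual (x n)) atTop (𝓝 0) := by
  have hspan : ∀ h ∈ Submodule.span 𝕜 (Set.range (coord 𝕜 w)),
      Tendsto (fun n => h.toDual (x n)) atTop (𝓝 0) := by
    intro h hh
    induction hh using Submodule.span_induction with
    | mem h hh =>
      obtain ⟨i, rfl⟩ := hh
      exact hx i
    | zero => exact tendsto_const_nhds
    | add f g _ _ hf hg => simpa [toDual_add] using hf.add hg
    | smul c f _ hf => simpa [toDual_smul] using hf.const_mul c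
  have hC0 : 0 ≤ C := (norm_nonneg _).trans (hC 0)
  rw [Metric.tendsto_atTop]
  intro ε hε
  have hf : f ∈ closure ((Submodule.span 𝕜 (Set.range (coord 𝕜 w)) : Set (LorentzPredual 𝕜 w))) := by
    have : f ∈ (Submodule.span 𝕜 (Set.range (coord 𝕜 w))).topologicalClosure := by
      rw [closure_span_coord]; trivial
    exact this
  obtain ⟨h, hh, hfh⟩ := Metric.mem_closure_iff.1 hf (ε / (2 * (C + 1))) (by positivity)
  obtain ⟨N, hN⟩ := Metric.tendsto_atTop.1 (hspan h hh) (ε / 2) (half_pos hε)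
  refine ⟨N, fun n hn => ?_⟩
  have h1 := hN n hn
  rw [dist_zero_right] at h1 ⊢
  have h2 : f.toDual (x n) = (f - h).toDual (x n) + h.toDual (x n) := by
    rw [← add_apply, ← toDual_add, sub_add_cancel]
  have h3 : ‖(f - h).toDual (x n)‖ ≤ ε / 2 := by
    refine (norm_toDual_apply_le _ _).trans ?_
    rw [dist_eq_norm] at hfh
    calc ‖f - h‖ * ‖x n‖ ≤ ε / (2 * (C + 1)) * (C + 1) := by
          gcongr
          exact (hC n).trans (by linarith)
      _ = ε / 2 := by field_simp
  rw [h2]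
  exact (norm_add_le _ _).trans_lt (by linarith)

variable (𝕜 w) in
/-- The evaluation of elements of the predual at the elements of `d(w, 1)`. -/
noncomputable def evalL : LorentzSpace 𝕜 w →L[𝕜] StrongDual 𝕜 (LorentzPredual 𝕜 w) :=
  (toDualL 𝕜 w).toContinuousLinearMap.flip

theorem evalL_apply (x : LorentzSpace 𝕜 w) (f : LorentzPredual 𝕜 w) :
    evalL 𝕜 w x f = f.toDual x := rfl

/-- Evaluate `φ` at `∑ w j * θ j • coord (π j)`, of norm at most one, with phases `θ j`. This bound
serves both the isometry and the surjectivity in the duality. -/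
theorem sum_norm_le (φ : StrongDual 𝕜 (LorentzPredual 𝕜 w)) (π : Equiv.Perm ℕ) (k : ℕ) :
    ∑ j ∈ Finset.range k, w.toFun j * ‖φ (coord 𝕜 w (π j))‖ ≤ ‖φ‖ := by
  choose θ hθ hθφ using fun j => RCLike.exists_norm_le_one_mul_eq_norm (φ (coord 𝕜 w (π j)))
  have hnorm := norm_sum_smul_coord_le (𝕜 := 𝕜) (w := w) (Finset.range k)
    (c := fun j => (w.toFun j : 𝕜) * θ j)
    (a := π) (b := id) π.injective.injOn Function.injective_id.injOn fun j _ => by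
      rw [norm_mul, RCLike.norm_ofReal, abs_of_pos (w.pos j)]
      exact mul_le_of_le_one_right (w.pos j).le (hθ j)
  refine le_trans (le_of_eq ?_) (φ.le_of_opNorm_le_of_le le_rfl hnorm |>.trans_eq (mul_one _))
  simp only [map_sum, map_smul, smul_eq_mul, mul_assoc, hθφ, ← RCLike.ofReal_mul]
  rw [← RCLike.ofReal_sum, RCLike.norm_ofReal, abs_of_nonneg]
  exact Finset.sum_nonneg fun j _ => mul_nonneg (w.pos j).le (norm_nonneg _)

variable (𝕜 w) in
/-- The space `d(w, 1)` is the dual of its predual. -/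
theorem exists_dual_equiv : ∃ e : LorentzSpace 𝕜 w ≃ₗᵢ[𝕜] StrongDual 𝕜 (LorentzPredual 𝕜 w),
    ∀ (x : LorentzSpace 𝕜 w) (f : LorentzPredual 𝕜 w), e x f = f.toDual x := by
  have hle : ∀ x : LorentzSpace 𝕜 w, ‖evalL 𝕜 w x‖ ≤ ‖x‖ := fun x =>
    ContinuousLinearMap.opNorm_le_bound _ (norm_nonneg _) fun f => by
      rw [mul_comm]
      exact norm_toDual_apply_le f x
  have hge : ∀ x : LorentzSpace 𝕜 w, ‖x‖ ≤ ‖evalL 𝕜 w x‖ := fun x =>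
    norm_le_of_sum_le fun π k => sum_norm_le (evalL 𝕜 w x) π k
  let li : LorentzSpace 𝕜 w →ₗᵢ[𝕜] StrongDual 𝕜 (LorentzPredual 𝕜 w) :=
    ⟨(evalL 𝕜 w).toLinearMap, fun x => le_antisymm (hle x) (hge x)⟩
  have hsurj : Function.Surjective li := by
    intro φ
    have hmem : extNorm w (fun n => φ (coord 𝕜 w n)) < ∞ :=
      (extNorm_le (sum_norm_le φ)).trans_lt ENNReal.ofReal_lt_top
    let x : LorentzSpace 𝕜 w := ⟨fun n => φ (coord 𝕜 w n), hmem⟩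
    refine ⟨x, ?_⟩
    refine ContinuousLinearMap.ext_on (s := Set.range (coord 𝕜 w)) ?_ ?_
    · rw [Submodule.dense_iff_topologicalClosure_eq_top]
      exact closure_span_coord
    · rintro _ ⟨n, rfl⟩
      rfl
  exact ⟨LinearIsometryEquiv.ofSurjective li hsurj, fun x f => rfl⟩

end LorentzPredual

/-! ### The space `c₀` -/

namespace ZeroAtInftyContinuousMap

variable {𝕜 : Type*} [RCLike 𝕜]

/-- The element of `c₀` given by a null sequence. -/
def ofNat (a : ℕ → 𝕜) (ha : Tendsto a atTop (𝓝 0)) : C₀(ℕ, 𝕜) where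
  toFun := a
  continuous_toFun := continuous_of_discreteTopology
  zero_at_infty' := by rwa [cocompact_eq_cofinite, Nat.cofinite_eq_atTop]

@[simp] theorem ofNat_apply (a : ℕ → 𝕜) (ha : Tendsto a atTop (𝓝 0)) (n : ℕ) :
    ofNat a ha n = a n := rfl

theorem norm_apply_le (a : C₀(ℕ, 𝕜)) (n : ℕ) : ‖a n‖ ≤ ‖a‖ := a.toBCF.norm_coe_le_norm n

theorem norm_le_of_forall {a : C₀(ℕ, 𝕜)} {C : ℝ} (hC : 0 ≤ C) (h : ∀ n, ‖a n‖ ≤ C) : ‖a‖ ≤ C :=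
  (BoundedContinuousFunction.norm_le (f := a.toBCF) hC).2 h

theorem tendsto_apply_zero (a : C₀(ℕ, 𝕜)) : Tendsto a atTop (𝓝 0) := by
  have := a.zero_at_infty'
  rwa [cocompact_eq_cofinite, Nat.cofinite_eq_atTop] at this

variable (𝕜) in
/-- The coordinate maps on `c₀`. -/
noncomputable def proj (n : ℕ) : C₀(ℕ, 𝕜) →L[𝕜] 𝕜 :=
  LinearMap.mkContinuous
    { toFun := fun a => a n
      map_add' := fun _ _ => rfl
      map_smul' := fun _ _ => rfl } 1 (fun a => (norm_apply_le a n).trans_eq (one_mul _).symm)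

@[simp] theorem proj_apply (n : ℕ) (a : C₀(ℕ, 𝕜)) : proj 𝕜 n a = a n := rfl

/-- A finitely supported sequence as an element of `c₀`. -/
noncomputable def ofFinset (s : Finset ℕ) (a : ℕ → 𝕜) : C₀(ℕ, 𝕜) :=
  ofNat ((s : Set ℕ).indicator a) <| by
    refine tendsto_const_nhds.congr' ?_
    obtain ⟨N, hN⟩ := s.bddAbove
    filter_upwards [eventually_gt_atTop N] with n hn
    rw [Set.indicator_of_notMem]
    exact fun h => absurd (hN h) (not_le.2 hn)

theorem ofFinset_apply (s : Finset ℕ) (a : ℕ → 𝕜) (n : ℕ) :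
    ofFinset s a n = (s : Set ℕ).indicator a n := rfl

variable (𝕜) in
/-- The unit vectors of `c₀`. -/
noncomputable def unit (n : ℕ) : C₀(ℕ, 𝕜) := ofFinset {n} 1

theorem unit_apply (n i : ℕ) : unit 𝕜 n i = if i = n then 1 else 0 := by
  change (({n} : Finset ℕ) : Set ℕ).indicator 1 i = _
  by_cases h : i = n <;> simp [h]

theorem sum_apply' {ι : Type*} (s : Finset ι) (u : ι → C₀(ℕ, 𝕜)) (i : ℕ) :
    (∑ t ∈ s, u t : C₀(ℕ, 𝕜)) i = ∑ t ∈ s, u t i :=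
  map_sum (proj 𝕜 i) u s

theorem ofFinset_eq_sum (s : Finset ℕ) (a : ℕ → 𝕜) : ofFinset s a = ∑ n ∈ s, a n • unit 𝕜 n := by
  ext j
  rw [sum_apply', ofFinset_apply]
  simp [unit_apply, Set.indicator_apply]

theorem norm_ofFinset_le (s : Finset ℕ) {a : ℕ → 𝕜} (ha : ∀ i, ‖a i‖ ≤ 1) :
    ‖ofFinset s a‖ ≤ 1 :=
  norm_le_of_forall zero_le_one fun n => (norm_indicator_le_norm_self _ _).trans (ha n)

theorem hasSum_smul_unit (a : C₀(ℕ, 𝕜)) : HasSum (fun n => a n • unit 𝕜 n) a := by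
  change Tendsto (fun s : Finset ℕ => ∑ n ∈ s, a n • unit 𝕜 n) atTop (𝓝 a)
  rw [Metric.tendsto_atTop]
  intro ε hε
  obtain ⟨N, hN⟩ := Metric.tendsto_atTop.1 (tendsto_apply_zero a) (ε / 2) (half_pos hε)
  refine ⟨Finset.range N, fun s hs => ?_⟩
  rw [dist_eq_norm, ← ofFinset_eq_sum]
  refine (norm_le_of_forall (half_pos hε).le fun n => ?_).trans_lt (half_lt_self hε)
  rw [sub_apply, ofFinset_apply]
  by_cases hn : n ∈ s
  · rw [Set.indicator_of_mem (by exact hn), sub_self, norm_zero]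
    exact (half_pos hε).le
  · rw [Set.indicator_of_notMem (by exact hn), zero_sub, norm_neg]
    have := hN n (not_lt.1 fun h => hn (hs (Finset.mem_range.2 h)))
    rw [dist_zero_right] at this
    exact this.le

/-- The part of `c₀* = ℓ₁` that is needed: the values at the unit vectors are absolutely summable.
-/
theorem sum_norm_apply_unit_le (φ : StrongDual 𝕜 C₀(ℕ, 𝕜)) (s : Finset ℕ) :
    ∑ n ∈ s, ‖φ (unit 𝕜 n)‖ ≤ ‖φ‖ := by
  choose θ hθ hθφ using fun n => RCLike.exists_norm_le_one_mul_eq_norm (φ (unit 𝕜 n))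
  refine le_trans (le_of_eq ?_)
    ((φ.le_of_opNorm_le_of_le le_rfl (norm_ofFinset_le s hθ)).trans_eq (mul_one _))
  rw [ofFinset_eq_sum, map_sum]
  simp only [map_smul, smul_eq_mul, hθφ]
  rw [← RCLike.ofReal_sum, RCLike.norm_ofReal, abs_of_nonneg]
  exact Finset.sum_nonneg fun j _ => norm_nonneg _

variable (𝕜) in
theorem not_finiteDimensional : ¬ FiniteDimensional 𝕜 C₀(ℕ, 𝕜) := by
  intro h
  let k := Module.finrank 𝕜 C₀(ℕ, 𝕜) + 1
  have hsurj : Function.Surjective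
      (LinearMap.pi fun i : Fin k => (proj 𝕜 (i : ℕ)).toLinearMap) := by
    intro v
    refine ⟨ofFinset (Finset.range k) fun n => if hn : n < k then v ⟨n, hn⟩ else 0, ?_⟩
    ext i
    simp [ofFinset_apply]
  have := LinearMap.finrank_le_finrank_of_surjective hsurj
  rw [Module.finrank_fin_fun] at this
  omega

end ZeroAtInftyContinuousMap

/-! ### Infinite-dimensional duals and complemented ranges -/

theorem not_finiteDimensional_strongDual {𝕜 : Type*} [RCLike 𝕜] {E : Type*}
    [NormedAddCommGroup E] [NormedSpace 𝕜 E] (h : ¬ FiniteDimensional 𝕜 E) :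
    ¬ FiniteDimensional 𝕜 (StrongDual 𝕜 E) := by
  intro hE
  have : FiniteDimensional 𝕜 (StrongDual 𝕜 (StrongDual 𝕜 E)) :=
    (LinearMap.toContinuousLinearMap (𝕜 := 𝕜) (E := StrongDual 𝕜 E) (F' := 𝕜)).finiteDimensional
  let J : E →ₗ[𝕜] StrongDual 𝕜 (StrongDual 𝕜 E) :=
    (NormedSpace.inclusionInDoubleDualLi (E := E) 𝕜).toLinearMap
  have hJ : Function.Injective J := (NormedSpace.inclusionInDoubleDualLi (E := E) 𝕜).injective
  exact h (FiniteDimensional.of_injective (V₂ := StrongDual 𝕜 (StrongDual 𝕜 E)) J hJ)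

theorem ContinuousLinearMap.range_complemented_of_leftInverse {𝕜 E F : Type*} [RCLike 𝕜]
    [NormedAddCommGroup E] [NormedSpace 𝕜 E] [NormedAddCommGroup F] [NormedSpace 𝕜 F]
    {A : E →L[𝕜] F} {B : F →L[𝕜] E} (h : Function.LeftInverse B A)
    (hE : ¬ FiniteDimensional 𝕜 E) :
    IsClosed (A.range : Set F) ∧ ¬ FiniteDimensional 𝕜 A.range ∧ A.range.ClosedComplemented := by
  have hcompl : A.range.ClosedComplemented :=
    ContinuousLinearMap.HasLeftInverse.closedComplemented_range ⟨B, h⟩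
  exact ⟨hcompl.isClosed, fun _ => hE
    (LinearEquiv.ofInjective A.toLinearMap h.injective).symm.finiteDimensional, hcompl⟩

/-! ### Almost biorthogonal sequences -/

/-- A normalized sequence in `d(w, 1)` moving to infinity and a weakly unconditionally Cauchy
sequence in the predual, almost biorthogonal to each other. -/
structure AlmostBiorthogonal {𝕜 : Type*} [RCLike 𝕜] {w : LorentzWeight}
    (x : ℕ → LorentzSpace 𝕜 w) (g : ℕ → LorentzPredual 𝕜 w) : Prop where
  norm_eq : ∀ n, ‖x n‖ = 1
  apply_eq_zero : ∀ n, ∀ i < n, x n i = 0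
  sum_norm_le : ∀ (s : Finset ℕ) (y : LorentzSpace 𝕜 w), ∑ n ∈ s, ‖(g n).toDual y‖ ≤ ‖y‖
  norm_sub_one_le : ∀ n, ‖(g n).toDual (x n) - 1‖ ≤ 1 / 8

namespace LorentzSpace

open LorentzPredual

variable {𝕜 : Type*} [RCLike 𝕜] {w : LorentzWeight}

/-- One step of the block construction. Flatness makes the first `N` weights negligible, so the
nearly norming functional can avoid them; confining both weights and coordinates to `[N, N')` is
what lets successive blocks be combined. -/
theorem exists_block {M : Submodule 𝕜 (LorentzSpace 𝕜 w)} (hM : ¬ FiniteDimensional 𝕜 M) (N : ℕ) :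
    ∃ (N' : ℕ) (x : LorentzSpace 𝕜 w) (D : Finset ℕ) (π : Equiv.Perm ℕ) (c : ℕ → 𝕜),
      N < N' ∧ x ∈ M ∧ ‖x‖ = 1 ∧ (∀ i < N, x i = 0) ∧
      (∀ j ∈ D, (N ≤ j ∧ j < N') ∧ (N ≤ π j ∧ π j < N') ∧ ‖c j‖ ≤ w.toFun j) ∧
      ‖∑ j ∈ D, c j * x (π j) - 1‖ ≤ 1 / 8 := by
  -- With coordinates this small, the first `N` weights, each at most `1`, contribute at most `1 /
  -- 16`.
  have hη : (0 : ℝ) < 1 / (16 * (N + 1)) := by positivity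
  obtain ⟨y, ⟨hyM, hyN⟩, hy0, hy⟩ := exists_flat_of_growth
    (J := fun i => (LorentzSpace.coord 𝕜 w i).toLinearMap) w.tendsto_partialSum
    mul_partialSum_le_norm (Submodule.not_finiteDimensional_inf_ker hM
      (LinearMap.pi fun i : Fin N => (LorentzSpace.coord 𝕜 w i).toLinearMap)) hη
  have hpos : 0 < ‖y‖ := norm_pos_iff.2 hy0
  obtain ⟨x, hxy⟩ : ∃ x, x = ((‖y‖ : 𝕜)⁻¹) • y := ⟨_, rfl⟩
  have hxi : ∀ i, x i = (‖y‖ : 𝕜)⁻¹ * y i := fun i => by rw [hxy]; rfl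
  have hx1 : ‖x‖ = 1 := by
    rw [hxy, norm_smul, norm_inv, RCLike.norm_ofReal, abs_norm, inv_mul_cancel₀ hpos.ne']
  have hxN : ∀ i < N, x i = 0 := fun i hi => by
    have : y i = 0 := congrFun hyN ⟨i, hi⟩
    rw [hxi, this, mul_zero]
  have hxs : ∀ i, ‖x i‖ ≤ 1 / (16 * (N + 1)) := fun i => by
    rw [hxi, norm_mul, norm_inv, RCLike.norm_ofReal, abs_norm, inv_mul_le_iff₀ hpos, mul_comm]
    exact hy i
  have hw1 : ∀ j, w.toFun j ≤ 1 := fun j => (w.antitone (Nat.zero_le j)).trans_eq w.first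
  obtain ⟨π, k, hπ⟩ : ∃ (π : Equiv.Perm ℕ) (k : ℕ),
      15 / 16 < ∑ j ∈ Finset.range k, w.toFun j * ‖x (π j)‖ := by
    by_contra! h
    have := norm_le_of_sum_le h
    rw [hx1] at this
    norm_num at this
  choose θ hθ hθx using fun j => RCLike.exists_norm_le_one_mul_eq_norm (x (π j))
  -- Dropping `j < N` costs at most `1 / 16`, dropping `π j < N` costs nothing as `x` vanishes
  -- there; at least `15 / 16 - 1 / 16 = 7 / 8` remains.
  let D := (Finset.range k).filter fun j => N ≤ j ∧ N ≤ π j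
  obtain ⟨B, hB⟩ := (D.image π).bddAbove
  refine ⟨N + k + B + 1, x, D, π, fun j => w.toFun j * θ j, by omega, ?_, hx1, hxN, ?_, ?_⟩
  · rw [hxy]
    exact M.smul_mem _ hyM
  · intro j hj
    have hj' := Finset.mem_filter.1 hj
    have h1 := Finset.mem_range.1 hj'.1
    have h2 : π j ≤ B := hB (Finset.mem_coe.2 (Finset.mem_image_of_mem π hj))
    refine ⟨⟨hj'.2.1, by omega⟩, ⟨hj'.2.2, by omega⟩, ?_⟩
    rw [norm_mul, RCLike.norm_ofReal, abs_of_pos (w.pos j)]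
    exact mul_le_of_le_one_right (w.pos j).le (hθ j)
  · simp only [mul_assoc, hθx, ← RCLike.ofReal_mul]
    have hup : ∑ j ∈ D, w.toFun j * ‖x (π j)‖ ≤ 1 := by
      rw [← hx1]
      exact sum_le_norm x D π.injective.injOn Function.injective_id.injOn
    have hlow : 7 / 8 ≤ ∑ j ∈ D, w.toFun j * ‖x (π j)‖ := by
      have hterm : ∀ j ∈ Finset.range k, w.toFun j * ‖x (π j)‖ ≤
          (if N ≤ j ∧ N ≤ π j then w.toFun j * ‖x (π j)‖ else 0) +
          (if j < N then 1 / (16 * ((N : ℝ) + 1)) else 0) := by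
        intro j _
        have hnn : 0 ≤ w.toFun j * ‖x (π j)‖ := mul_nonneg (w.pos j).le (norm_nonneg _)
        rcases lt_or_ge j N with hj | hj
        · rw [if_neg (by omega), if_pos hj, zero_add]
          exact (mul_le_of_le_one_left (norm_nonneg _) (hw1 j)).trans (hxs _)
        · rw [if_neg (not_lt.2 hj), add_zero]
          rcases lt_or_ge (π j) N with hj' | hj'
          · rw [hxN _ hj', if_neg (by omega)]
            simp
          · rw [if_pos ⟨hj, hj'⟩]
      have hsum := Finset.sum_le_sum hterm
      rw [Finset.sum_add_distrib, ← Finset.sum_filter, ← Finset.sum_filter, Finset.sum_const,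
        nsmul_eq_mul] at hsum
      have hcard : (((Finset.range k).filter fun j => j < N).card : ℝ) ≤ N := by
        have : (Finset.range k).filter (fun j => j < N) ⊆ Finset.range N := fun j hj =>
          Finset.mem_range.2 (Finset.mem_filter.1 hj).2
        exact_mod_cast (Finset.card_le_card this).trans_eq (Finset.card_range N)
      have h16 : (N : ℝ) * (1 / (16 * ((N : ℝ) + 1))) ≤ 1 / 16 := by
        rw [mul_one_div, div_le_div_iff₀ (by positivity) (by norm_num)]
        linarith
      have := mul_le_mul_of_nonneg_right hcard hη.le
      change _ ≤ ∑ j ∈ D, _ + _ at hsum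
      linarith
    rw [← RCLike.ofReal_sum, ← RCLike.ofReal_one, ← RCLike.ofReal_sub, RCLike.norm_ofReal,
      abs_le]
    constructor <;> linarith

/-- The intervals `[u n, u (n + 1))` are disjoint, so across all blocks no weight and no coordinate
is used twice, and `∑ ‖g n y‖` is bounded by a single admissible sum for `y`. -/
theorem exists_almostBiorthogonal {M : Submodule 𝕜 (LorentzSpace 𝕜 w)}
    (hM : ¬ FiniteDimensional 𝕜 M) :
    ∃ (x : ℕ → LorentzSpace 𝕜 w) (g : ℕ → LorentzPredual 𝕜 w),
      (∀ n, x n ∈ M) ∧ AlmostBiorthogonal x g := by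
  choose N' x D π c hN' hxM hx1 hxN hD hg using exists_block hM
  let u : ℕ → ℕ := fun n => n.rec 0 fun _ m => N' m
  have hu : StrictMono u := strictMono_nat_of_lt_succ fun n => hN' (u n)
  have huniq : ∀ {m n j : ℕ}, u m ≤ j → j < u (m + 1) → u n ≤ j → j < u (n + 1) → m = n := by
    intro m n j h1 h2 h3 h4
    have h5 : m < n + 1 := hu.lt_iff_lt.1 (h1.trans_lt h4)
    have h6 : n < m + 1 := hu.lt_iff_lt.1 (h3.trans_lt h2)
    omega
  have happ : ∀ (n : ℕ) (y : LorentzSpace 𝕜 w),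
      (∑ j ∈ D (u n), c (u n) j • LorentzPredual.coord 𝕜 w (π (u n) j)).toDual y =
        ∑ j ∈ D (u n), c (u n) j * y (π (u n) j) := fun n y => by
    rw [toDual_sum]
    exact sum_smul_coord_apply _ _ _ y
  refine ⟨fun n => x (u n), fun n => ∑ j ∈ D (u n), c (u n) j • LorentzPredual.coord 𝕜 w (π (u n) j),
    fun n => hxM _, fun n => hx1 _, fun n i hi => hxN _ i (hi.trans_le hu.le_apply), ?_, ?_⟩
  · intro s y
    calc ∑ n ∈ s, ‖(∑ j ∈ D (u n), c (u n) j • LorentzPredual.coord 𝕜 w (π (u n) j)).toDual y‖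
        ≤ ∑ n ∈ s, ∑ j ∈ D (u n), w.toFun j * ‖y (π (u n) j)‖ := by
          refine Finset.sum_le_sum fun n _ => ?_
          rw [happ]
          refine (norm_sum_le _ _).trans (Finset.sum_le_sum fun j hj => ?_)
          rw [norm_mul]
          exact mul_le_mul_of_nonneg_right (hD _ j hj).2.2 (norm_nonneg _)
      _ = ∑ t ∈ s.sigma fun n => D (u n), w.toFun t.2 * ‖y (π (u t.1) t.2)‖ :=
          (Finset.sum_sigma s (fun n => D (u n))
            fun t => w.toFun t.2 * ‖y (π (u t.1) t.2)‖).symm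
      _ ≤ ‖y‖ := by
          refine sum_le_norm y _ (a := fun t : (_ : ℕ) × ℕ => π (u t.1) t.2) (b := fun t => t.2) ?_ ?_
          · rintro ⟨n, j⟩ ht ⟨n', j'⟩ ht' h
            have h1 := hD _ j (Finset.mem_sigma.1 ht).2
            have h2 := hD _ j' (Finset.mem_sigma.1 ht').2
            simp only at h h1 h2
            obtain rfl : n = n' := huniq (h ▸ h1.2.1.1) (h ▸ h1.2.1.2) h2.2.1.1 h2.2.1.2
            rw [(π (u n)).injective h]
          · rintro ⟨n, j⟩ ht ⟨n', j'⟩ ht' h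
            have h1 := hD _ j (Finset.mem_sigma.1 ht).2
            have h2 := hD _ j' (Finset.mem_sigma.1 ht').2
            simp only at h h1 h2
            subst h
            obtain rfl : n = n' := huniq h1.1.1 h1.1.2 h2.1.1 h2.1.2
            rfl
  · intro n
    rw [happ]
    exact hg (u n)

end LorentzSpace

/-! ### Operators between the predual and `c₀` -/

namespace LorentzPredual

open LorentzSpace ZeroAtInftyContinuousMap

variable {𝕜 : Type*} [RCLike 𝕜] {w : LorentzWeight}

/-- The operator `f ↦ (f (x n))ₙ` from the predual to `c₀`, for a bounded sequence `x` in
`d(w, 1)` moving to infinity. -/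
noncomputable def toC0 (x : ℕ → LorentzSpace 𝕜 w) (hx : ∀ n, ‖x n‖ = 1)
    (hx0 : ∀ n, ∀ i < n, x n i = 0) : LorentzPredual 𝕜 w →L[𝕜] C₀(ℕ, 𝕜) :=
  LinearMap.mkContinuous
    { toFun := fun f => ofNat (fun n => f.toDual (x n)) <|
        tendsto_toDual_zero (fun n => (hx n).le) (fun i => tendsto_const_nhds.congr' <| by
          filter_upwards [eventually_gt_atTop i] with n hn
          exact (hx0 n i hn).symm) f
      map_add' := fun _ _ => rfl
      map_smul' := fun _ _ => rfl } 1 fun f => by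
    refine norm_le_of_forall (by positivity) fun n => ?_
    rw [one_mul]
    exact (norm_toDual_apply_le f (x n)).trans_eq (by rw [hx, mul_one])

theorem toC0_apply (x : ℕ → LorentzSpace 𝕜 w) (hx : ∀ n, ‖x n‖ = 1)
    (hx0 : ∀ n, ∀ i < n, x n i = 0) (f : LorentzPredual 𝕜 w) (n : ℕ) :
    toC0 x hx hx0 f n = f.toDual (x n) := rfl

end LorentzPredual

namespace AlmostBiorthogonal

open LorentzSpace LorentzPredual ZeroAtInftyContinuousMap

variable {𝕜 : Type*} [RCLike 𝕜] {w : LorentzWeight}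
  {x : ℕ → LorentzSpace 𝕜 w} {g : ℕ → LorentzPredual 𝕜 w}

/-- The upper `c₀` estimate that makes `∑ a n • g n` converge for null sequences `a`. -/
theorem norm_sum_smul_le (h : AlmostBiorthogonal x g) (s : Finset ℕ) {a : ℕ → 𝕜} {C : ℝ}
    (hC : 0 ≤ C) (ha : ∀ n ∈ s, ‖a n‖ ≤ C) : ‖∑ n ∈ s, a n • g n‖ ≤ C := by
  rw [← LorentzPredual.norm_toDual]
  refine ContinuousLinearMap.opNorm_le_bound _ hC fun y => ?_
  have : (∑ n ∈ s, a n • g n).toDual y = ∑ n ∈ s, a n * (g n).toDual y := by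
    simp [toDual_sum, LorentzPredual.toDual_smul]
  rw [this]
  calc ‖∑ n ∈ s, a n * (g n).toDual y‖ ≤ ∑ n ∈ s, C * ‖(g n).toDual y‖ := by
        refine (norm_sum_le _ _).trans (Finset.sum_le_sum fun n hn => ?_)
        rw [norm_mul]
        exact mul_le_mul_of_nonneg_right (ha n hn) (norm_nonneg _)
    _ ≤ C * ‖y‖ := by
        rw [← Finset.mul_sum]
        exact mul_le_mul_of_nonneg_left (h.sum_norm_le s y) hC

theorem summable_smul (h : AlmostBiorthogonal x g) (a : C₀(ℕ, 𝕜)) :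
    Summable fun n => a n • g n := by
  rw [summable_iff_vanishing_norm]
  intro ε hε
  obtain ⟨N, hN⟩ := Metric.tendsto_atTop.1 (tendsto_apply_zero a) (ε / 2) (half_pos hε)
  refine ⟨Finset.range N, fun t ht => ?_⟩
  refine (h.norm_sum_smul_le t (half_pos hε).le fun n hn => ?_).trans_lt (half_lt_self hε)
  have := hN n (not_lt.1 fun hlt => Finset.disjoint_left.1 ht hn (Finset.mem_range.2 hlt))
  rw [dist_zero_right] at this
  exact this.le

/-- The operator `a ↦ ∑ a n • g n` from `c₀` to the predual. -/
noncomputable def ofC0 (h : AlmostBiorthogonal x g) : C₀(ℕ, 𝕜) →L[𝕜] LorentzPredual 𝕜 w :=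
  LinearMap.mkContinuous
    { toFun := fun a => ∑' n, a n • g n
      map_add' := fun a b => by
        rw [← (h.summable_smul a).tsum_add (h.summable_smul b)]
        simp [add_smul]
      map_smul' := fun c a => by
        rw [RingHom.id_apply, ← (h.summable_smul a).tsum_const_smul]
        simp [mul_smul] } 1 fun a => by
    rw [one_mul]
    exact le_of_tendsto (h.summable_smul a).hasSum.norm <| Eventually.of_forall fun s =>
      h.norm_sum_smul_le s (norm_nonneg _) fun n _ => norm_apply_le a n

theorem hasSum_ofC0 (h : AlmostBiorthogonal x g) (a : C₀(ℕ, 𝕜)) (y : LorentzSpace 𝕜 w) :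
    HasSum (fun n => a n * (g n).toDual y) ((h.ofC0 a).toDual y) := by
  have h1 : HasSum (fun n => a n • g n) (h.ofC0 a) := (h.summable_smul a).hasSum
  have h2 := (evalL 𝕜 w y).hasSum h1
  simpa only [map_smul, smul_eq_mul, evalL_apply] using h2

/-- The operator `f ↦ (f (x n))ₙ` from the predual to `c₀`. -/
noncomputable abbrev toC0 (h : AlmostBiorthogonal x g) : LorentzPredual 𝕜 w →L[𝕜] C₀(ℕ, 𝕜) :=
  LorentzPredual.toC0 x h.norm_eq h.apply_eq_zero

/-- In row `m` of the matrix `g n (x m)` the diagonal entry is within `1 / 8` of `1`. The moduli in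
the row sum to at most `1`, so the rest of the row sums to at most `1 / 8`, and the distance to the
identity is at most `1 / 4`. -/
theorem norm_one_sub_comp_lt (h : AlmostBiorthogonal x g) :
    ‖(1 : C₀(ℕ, 𝕜) →L[𝕜] C₀(ℕ, 𝕜)) - h.toC0 ∘L h.ofC0‖ < 1 := by
  refine lt_of_le_of_lt (b := 1 / 4) ?_ (by norm_num)
  refine ContinuousLinearMap.opNorm_le_bound _ (by norm_num) fun a => ?_
  refine norm_le_of_forall (by positivity) fun m => ?_
  change ‖a m - (h.ofC0 a).toDual (x m)‖ ≤ _
  refine le_of_tendsto ((h.hasSum_ofC0 a (x m)).const_sub (a m)).norm ?_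
  filter_upwards [eventually_ge_atTop {m}] with s hs
  have hm : m ∈ s := hs (Finset.mem_singleton_self m)
  have h1 := h.norm_sub_one_le m
  have h2 := h.sum_norm_le s (x m)
  rw [h.norm_eq, ← Finset.add_sum_erase s _ hm] at h2
  have h3 : 1 - ‖(g m).toDual (x m)‖ ≤ ‖(g m).toDual (x m) - 1‖ := by
    have := norm_sub_norm_le (1 : 𝕜) ((g m).toDual (x m))
    rwa [norm_one, norm_sub_rev] at this
  have h4 : ‖∑ n ∈ s.erase m, a n * (g n).toDual (x m)‖ ≤
      ‖a‖ * ∑ n ∈ s.erase m, ‖(g n).toDual (x m)‖ := by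
    rw [Finset.mul_sum]
    refine (norm_sum_le _ _).trans (Finset.sum_le_sum fun n _ => ?_)
    rw [norm_mul]
    exact mul_le_mul_of_nonneg_right (norm_apply_le a n) (norm_nonneg _)
  have h5 : ‖a m * ((g m).toDual (x m) - 1)‖ ≤ ‖a‖ * (1 / 8) := by
    rw [norm_mul]
    exact mul_le_mul (norm_apply_le a m) h1 (norm_nonneg _) (norm_nonneg _)
  have h6 : ‖a‖ * ∑ n ∈ s.erase m, ‖(g n).toDual (x m)‖ ≤ ‖a‖ * (1 / 8) :=
    mul_le_mul_of_nonneg_left (by linarith) (norm_nonneg _)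
  rw [← Finset.add_sum_erase s _ hm]
  calc ‖a m - (a m * (g m).toDual (x m) + ∑ n ∈ s.erase m, a n * (g n).toDual (x m))‖
      = ‖a m * ((g m).toDual (x m) - 1) + ∑ n ∈ s.erase m, a n * (g n).toDual (x m)‖ := by
        rw [← norm_neg]
        congr 1
        ring
    _ ≤ 1 / 4 * ‖a‖ := (norm_add_le _ _).trans (by linarith)

/-- By the Neumann series `toC0 ∘ ofC0` is invertible; compose `ofC0` with its inverse. -/
theorem exists_rightInverse_toC0 (h : AlmostBiorthogonal x g) :
    ∃ H : C₀(ℕ, 𝕜) →L[𝕜] LorentzPredual 𝕜 w, ∀ a, h.toC0 (H a) = a := by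
  let v := Units.oneSub (R := C₀(ℕ, 𝕜) →L[𝕜] C₀(ℕ, 𝕜)) _ h.norm_one_sub_comp_lt
  have hv : (v : C₀(ℕ, 𝕜) →L[𝕜] C₀(ℕ, 𝕜)) = h.toC0 ∘L h.ofC0 :=
    sub_sub_cancel (1 : C₀(ℕ, 𝕜) →L[𝕜] C₀(ℕ, 𝕜)) _
  refine ⟨h.ofC0 ∘L (v⁻¹ : (C₀(ℕ, 𝕜) →L[𝕜] C₀(ℕ, 𝕜))ˣ).1, fun a => ?_⟩
  have := congrArg (fun T : C₀(ℕ, 𝕜) →L[𝕜] C₀(ℕ, 𝕜) => T a) v.mul_inv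
  rw [hv] at this
  exact this

/-- The adjoint of `toC0` sends `φ` to the absolutely convergent sum `∑ φ (unit n) • x n`, so its
range stays in the closed subspace `M`. -/
theorem exists_mem_apply_eq (h : AlmostBiorthogonal x g) {M : Submodule 𝕜 (LorentzSpace 𝕜 w)}
    (hM : IsClosed (M : Set (LorentzSpace 𝕜 w))) (hx : ∀ n, x n ∈ M)
    (φ : StrongDual 𝕜 C₀(ℕ, 𝕜)) :
    ∃ y ∈ M, ∀ f : LorentzPredual 𝕜 w, f.toDual y = φ (h.toC0 f) := by
  have hsum : Summable fun n => φ (ZeroAtInftyContinuousMap.unit 𝕜 n) • x n := by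
    refine Summable.of_norm ?_
    simp only [norm_smul, h.norm_eq, mul_one]
    exact summable_of_sum_le (fun _ => norm_nonneg _) (sum_norm_apply_unit_le φ)
  refine ⟨∑' n, φ (ZeroAtInftyContinuousMap.unit 𝕜 n) • x n,
    hM.mem_of_tendsto hsum.hasSum <| Eventually.of_forall fun s =>
      M.sum_mem fun n _ => M.smul_mem _ (hx n), fun f => ?_⟩
  have h1 := f.toDual.hasSum hsum.hasSum
  have h2 := φ.hasSum (hasSum_smul_unit (h.toC0 f))
  simp only [map_smul, smul_eq_mul, LorentzPredual.toC0_apply] at h1 h2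
  refine h1.unique (h2.congr_fun ?_)
  exact fun n => mul_comm _ _

end AlmostBiorthogonal

/-! ### Subprojectivity, superprojectivity and failure of `Sp(U⁻¹ ∘ K)` -/

namespace LorentzPredual

open LorentzSpace ZeroAtInftyContinuousMap

variable (𝕜 : Type*) [RCLike 𝕜] (w : LorentzWeight)

theorem isSubprojective_lorentzSpace : IsSubprojective 𝕜 (LorentzSpace 𝕜 w) := by
  intro M hMc hM
  obtain ⟨x, g, hxM, h⟩ := exists_almostBiorthogonal hM
  obtain ⟨H, hH⟩ := h.exists_rightInverse_toC0
  obtain ⟨e, he⟩ := exists_dual_equiv 𝕜 w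
  -- Up to the duality `e`, `A` and `B` are the adjoints of `toC0` and of its right inverse `H`,
  -- hence `B ∘ A = id`.
  let A : StrongDual 𝕜 C₀(ℕ, 𝕜) →L[𝕜] LorentzSpace 𝕜 w :=
    e.symm.toLinearIsometry.toContinuousLinearMap.comp (ContinuousLinearMap.precomp 𝕜 h.toC0)
  let B : LorentzSpace 𝕜 w →L[𝕜] StrongDual 𝕜 C₀(ℕ, 𝕜) :=
    (ContinuousLinearMap.precomp 𝕜 H).comp e.toLinearIsometry.toContinuousLinearMap
  have hA : ∀ φ, A φ = e.symm (φ.comp h.toC0) := fun _ => rfl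
  have hB : ∀ y, B y = (e y).comp H := fun _ => rfl
  have hBA : Function.LeftInverse B A := by
    intro φ
    ext a
    rw [hB, hA, e.apply_symm_apply]
    exact congrArg φ (hH a)
  refine ⟨A.range, ?_, ContinuousLinearMap.range_complemented_of_leftInverse hBA
    (not_finiteDimensional_strongDual (ZeroAtInftyContinuousMap.not_finiteDimensional 𝕜))⟩
  rintro _ ⟨φ, rfl⟩
  obtain ⟨y, hyM, hy⟩ := h.exists_mem_apply_eq hMc hxM φ
  have hyA : A φ = y := by
    rw [hA, LinearIsometryEquiv.symm_apply_eq]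
    ext f
    rw [he, hy]
    rfl
  exact hyA ▸ hyM

theorem isSuperprojective : IsSuperprojective 𝕜 (LorentzPredual 𝕜 w) := by
  intro M hMc hM
  obtain ⟨e, he⟩ := exists_dual_equiv 𝕜 w
  -- The annihilator of `M`. The dual of the quotient by `M` embeds in it, so it is
  -- infinite-dimensional; vectors `x n` chosen in `L` make `toC0` vanish on `M`.
  let L : Submodule 𝕜 (LorentzSpace 𝕜 w) :=
    ⨅ f ∈ M, LinearMap.ker f.toDual.toLinearMap
  have hL : ∀ {y}, y ∈ L ↔ ∀ f ∈ M, f.toDual y = 0 := by simp [L, Submodule.mem_iInf]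
  have hLinf : ¬ FiniteDimensional 𝕜 L := by
    intro hfin
    have : IsClosed (M : Set (LorentzPredual 𝕜 w)) := hMc
    let A : StrongDual 𝕜 (LorentzPredual 𝕜 w ⧸ M) →ₗ[𝕜] LorentzSpace 𝕜 w :=
      e.symm.toLinearEquiv.toLinearMap ∘ₗ
        (ContinuousLinearMap.precomp 𝕜 M.mkQL).toLinearMap
    have hA : ∀ ψ, e (A ψ) = ψ.comp M.mkQL := fun ψ => e.apply_symm_apply _
    have hAL : ∀ ψ, A ψ ∈ L := fun ψ => hL.2 fun f hf => by
      rw [← he, hA]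
      change ψ (M.mkQ f) = 0
      rw [show M.mkQ f = 0 from (Submodule.Quotient.mk_eq_zero M).2 hf, map_zero]
    have hAinj : Function.Injective (A.codRestrict L hAL) := fun ψ ψ' h => by
      have h1 : ψ.comp M.mkQL = ψ'.comp M.mkQL := by
        rw [← hA, ← hA]
        exact congrArg e (congrArg Subtype.val h)
      ext q
      obtain ⟨f, rfl⟩ := M.mkQ_surjective q
      exact congrArg (fun T : StrongDual 𝕜 (LorentzPredual 𝕜 w) => T f) h1
    exact not_finiteDimensional_strongDual hM (Module.Finite.of_injective _ hAinj)
  obtain ⟨x, g, hxL, h⟩ := exists_almostBiorthogonal hLinf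
  obtain ⟨H, hH⟩ := h.exists_rightInverse_toC0
  refine ⟨LinearMap.ker h.toC0.toLinearMap, fun f hf => ?_, h.toC0.isClosed_ker, fun hfin => ?_,
    ContinuousLinearMap.closedComplemented_ker_of_rightInverse h.toC0 H hH⟩
  · rw [LinearMap.mem_ker]
    ext n
    exact hL.1 (hxL n) f hf
  · have hsurj : Function.Surjective h.toC0.toLinearMap := fun a => ⟨H a, hH a⟩
    exact ZeroAtInftyContinuousMap.not_finiteDimensional 𝕜
      (LinearMap.quotKerEquivOfSurjective _ hsurj).finiteDimensional

theorem not_memSpUinvK : ¬ MemSpUinvK 𝕜 (LorentzPredual 𝕜 w) := by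
  intro hSp
  -- The coordinate embedding `f ↦ (f (unit n))` into `c₀`.
  let T := toC0 (LorentzSpace.unit 𝕜 w) norm_unit fun n i hi => by
    rw [LorentzSpace.unit_apply, if_neg hi.ne]
  have hT : IsUnconditionallyConverging T := by
    rintro ⟨M, -, ⟨ι⟩, c, hc, hcM⟩
    have hM : ¬ FiniteDimensional 𝕜 M := fun h =>
      ZeroAtInftyContinuousMap.not_finiteDimensional 𝕜 ι.toLinearEquiv.finiteDimensional
    -- Only the infinite dimension of `M` matters: a vector that is flat with constant `c / 2`
    -- violates the lower bound `c`.
    obtain ⟨f, hfM, hf0, hf⟩ := exists_flat_of_growth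
      (J := fun i => (evalL 𝕜 w (LorentzSpace.unit 𝕜 w i)).toLinearMap) w.tendsto_div_partialSum
      (fun f s => mul_div_partialSum_le_norm f.toDual s) hM (half_pos hc)
    have h1 : ‖T f‖ ≤ c / 2 * ‖f‖ := norm_le_of_forall (by positivity) hf
    have h2 := hcM f hfM
    have h3 : 0 < ‖f‖ := norm_pos_iff.2 hf0
    nlinarith
  -- `T` maps the coordinate functionals, which lie in the unit ball, to the unit vectors of `c₀`,
  -- which are at mutual distance at least `1`.
  obtain ⟨K, hK, hTK⟩ := (hSp C₀(ℕ, 𝕜) T hT).image_closedBall_subset_compact 1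
  obtain ⟨a, -, ψ, hψ, ha⟩ := hK.tendsto_subseq (x := fun n => T (coord 𝕜 w n)) fun n =>
    hTK ⟨_, by simpa using norm_coord_le n, rfl⟩
  obtain ⟨N, hN⟩ := Metric.cauchySeq_iff.1 ha.cauchySeq 1 one_pos
  have h1 := hN N le_rfl (N + 1) (Nat.le_succ N)
  rw [dist_eq_norm] at h1
  have h2 := norm_apply_le (T (coord 𝕜 w (ψ N)) - T (coord 𝕜 w (ψ (N + 1)))) (ψ N)
  have hTc : ∀ m n, T (coord 𝕜 w m) n = if m = n then 1 else 0 := fun m n =>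
    LorentzSpace.unit_apply (w := w) n m
  have h3 : ψ (N + 1) ≠ ψ N := (hψ N.lt_succ_self).ne'
  rw [ZeroAtInftyContinuousMap.sub_apply, hTc, hTc, if_pos rfl, if_neg h3, sub_zero, norm_one] at h2
  exact absurd h1 (not_lt.2 h2)

end LorentzPredual

theorem mainTheorem8 (𝕜 : Type*) [RCLike 𝕜] (w : LorentzWeight) :
    (∃ e : LorentzSpace 𝕜 w ≃ₗᵢ[𝕜] StrongDual 𝕜 (LorentzPredual 𝕜 w),
      ∀ (x : LorentzSpace 𝕜 w) (f : LorentzPredual 𝕜 w), e x f = f.toDual x) ∧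
    IsSubprojective 𝕜 (LorentzSpace 𝕜 w) ∧
    IsSuperprojective 𝕜 (LorentzPredual 𝕜 w) ∧
    ¬ HasSchurProperty 𝕜 (LorentzSpace 𝕜 w) ∧
    ¬ MemSpUinvK 𝕜 (LorentzPredual 𝕜 w) :=
  ⟨LorentzPredual.exists_dual_equiv 𝕜 w, LorentzPredual.isSubprojective_lorentzSpace 𝕜 w,
    LorentzPredual.isSuperprojective 𝕜 w, LorentzSpace.not_hasSchurProperty,
    LorentzPredual.not_memSpUinvK 𝕜 w⟩
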